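/- For $N\in\mathbb N$ and probabilities $p_A,p_B,p_{eA},p_{eB},p_{eAB}$ with $p_A+p_B\le 1$, let $H(N,p_A,p_B,p_{eA},p_{eB},p_{eAB})$ be the random graph sampled as follows. Independently for each element of $[N]$, put it in $A$ with probability $p_A$, in $B$ with probability $p_B$, and discard it with probability $1-p_A-p_B$. The vertex set is $A\cup B$. Given $A$ and $B$, each pair of distinct vertices becomes an edge independently, with probability $p_{eA}$ if both lie in $A$, $p_{eB}$ if both lie in $B$, and $p_{eAB}$ if one lies in $A$ and the other in $B$. For a finite graph without isolated vertices and with at least two vertices, with adjacency matrix $M$ and degree matrix $D$, the normalized Laplacian is $\mathcal L=D^{-1/2}(D-M)D^{-1/2}$, and the spectral gap is the second smallest eigenvalue of $\mathcal L$, counted with multiplicity. **Lemma.** Let $d\ge 1$ be an integer, let $0<\alpha<1/d$ and let $\delta>0$. Then with overwhelming probability the random graph $$H\sim H\bigl(n-2d,\; n^{-d\alpha}(1-n^{-\alpha})^d,\; n^{-d\alpha}(1-n^{-\alpha})^d,\; 0,\; 0,\; 1-n^{-\alpha}\bigr)$$ has at least two vertices and no isolated vertices, and the spectral gap of its normalized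 Laplacian is larger than $1-\delta$. Here "with overwhelming probability" means that there is a function $\omega\colon\mathbb N\to\mathbb R$ with $\omega(n)\to\infty$ such that, for all sufficiently large $n$, the event has probability at least $1-n^{-\omega(n)}$. -/

import Mathlib

open MeasureTheory Filter Topology

/-- The three possible roles of a point of the ground set: it is put into `A`, put into `B`,
or excluded from the graph. -/
inductive Role : Type
  | A
  | B
  | out
  deriving DecidableEq

instance : Fintype Role := ⟨{Role.A, Role.B, Role.out}, by intro x; cases x <;> simp⟩

instance : MeasurableSpace Role := ⊤

instance : DiscreteMeasurableSpace Role := ⟨fun _ => trivial⟩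

/-- Law of the role of one point: `A` with probability `pA`, `B` with probability `pB`,
excluded with probability `1 - pA - pB`. -/
noncomputable def roleLaw (pA pB : ℝ) : Measure Role :=
  ENNReal.ofReal pA • Measure.dirac Role.A + ENNReal.ofReal pB • Measure.dirac Role.B
    + ENNReal.ofReal (1 - pA - pB) • Measure.dirac Role.out

/-- Law of a coin showing `true` with probability `p`. -/
noncomputable def coinLaw (p : ℝ) : Measure Bool :=
  ENNReal.ofReal p • Measure.dirac true + ENNReal.ofReal (1 - p) • Measure.dirac false

/-- The probability that the pair `e` becomes an edge, given the roles `c` of all points.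
(The value on loops is irrelevant, see `sampledGraph`.) -/
noncomputable def edgeProb {N : ℕ} (peA peB peAB : ℝ) (c : Fin N → Role) (e : Sym2 (Fin N)) : ℝ :=
  if e.map c = s(Role.A, Role.A) then peA
  else if e.map c = s(Role.B, Role.B) then peB
  else if e.map c = s(Role.A, Role.B) then peAB
  else 0

/-- The random graph model `H(N, pA, pB, peA, peB, peAB)`: first the roles of the `N` points are
drawn independently; given the roles, the edge indicators are drawn independently with the
probabilities `edgeProb`. An outcome consists of the roles and the edge indicators. -/
noncomputable def linkGraphLaw (N : ℕ) (pA pB peA peB peAB : ℝ) :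
    Measure ((Fin N → Role) × (Sym2 (Fin N) → Bool)) :=
  (Measure.pi fun _ : Fin N => roleLaw pA pB).bind fun c =>
    (Measure.pi fun e : Sym2 (Fin N) => coinLaw (edgeProb peA peB peAB c e)).map fun E => (c, E)

/-- The graph of an outcome. Its vertices are the points that were not excluded, and two distinct
vertices are adjacent when the indicator of their pair is `true`. -/
def sampledGraph {N : ℕ} (ω : (Fin N → Role) × (Sym2 (Fin N) → Bool)) :
    SimpleGraph {v : Fin N // ω.1 v ≠ Role.out} :=
  (SimpleGraph.fromEdgeSet {e | ω.2 e = true}).comap Subtype.val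

open Classical in
/-- The normalized Laplacian `D^(-1/2) (D - A) D^(-1/2)` (of a graph without isolated vertices). -/
noncomputable def normalizedLaplacian {V : Type*} [Fintype V] (G : SimpleGraph V) :
    Matrix V V ℝ :=
  Matrix.diagonal (fun v => (Real.sqrt (G.degree v))⁻¹) * G.lapMatrix ℝ *
    Matrix.diagonal (fun v => (Real.sqrt (G.degree v))⁻¹)

theorem normalizedLaplacian_isHermitian {V : Type*} [Fintype V] (G : SimpleGraph V) :
    (normalizedLaplacian G).IsHermitian := by
  classical
  have h : (G.lapMatrix ℝ).transpose = G.lapMatrix ℝ := G.isSymm_lapMatrix ℝ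
  rw [Matrix.IsHermitian, Matrix.conjTranspose_eq_transpose_of_trivial, normalizedLaplacian]
  simp only [Matrix.transpose_mul, Matrix.diagonal_transpose, Matrix.mul_assoc]
  rw [h]

open Classical in
/-- The spectral gap: the second smallest eigenvalue, counted with multiplicity, of the normalized
Laplacian. (`eigenvalues₀` lists the eigenvalues in decreasing order. Graphs with fewer than two
vertices have no spectral gap and get the value `0`.) -/
noncomputable def spectralGap {V : Type*} [Fintype V] (G : SimpleGraph V) : ℝ :=
  if h : 2 ≤ Fintype.card V then
    (normalizedLaplacian_isHermitian G).eigenvalues₀ ⟨Fintype.card V - 2, by omega⟩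
  else 0

/-- The graph has at least two vertices and no isolated vertex, so that its normalized Laplacian
and its spectral gap are defined, and the spectral gap is larger than `r`. -/
def SpectralGapGT {V : Type*} [Fintype V] (G : SimpleGraph V) (r : ℝ) : Prop :=
  2 ≤ Fintype.card V ∧ (∀ v, ¬ G.IsIsolated v) ∧ r < spectralGap G

/-- `P n`, the probability of the `n`-th event, is at least `1 - n ^ (-ω(1))`. -/
def WithOverwhelmingProbability (P : ℕ → ℝ) : Prop :=
  ∃ w : ℕ → ℝ, Tendsto w atTop atTop ∧ ∀ᶠ n : ℕ in atTop, 1 - (n : ℝ) ^ (-w n) ≤ P n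

/-- The model is a genuine probability space whenever the parameters are probabilities. -/
theorem isProbabilityMeasure_linkGraphLaw (N : ℕ) {pA pB peA peB peAB : ℝ}
    (hA : 0 ≤ pA) (hB : 0 ≤ pB) (hAB : pA + pB ≤ 1)
    (h1 : peA ∈ Set.Icc (0 : ℝ) 1) (h2 : peB ∈ Set.Icc (0 : ℝ) 1)
    (h3 : peAB ∈ Set.Icc (0 : ℝ) 1) :
    IsProbabilityMeasure (linkGraphLaw N pA pB peA peB peAB) := by
  have hrole : IsProbabilityMeasure (roleLaw pA pB) := ⟨by
    simp only [roleLaw, Measure.coe_add, Measure.coe_smul, Pi.add_apply, Pi.smul_apply,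
      measure_univ, smul_eq_mul, mul_one]
    rw [← ENNReal.ofReal_add hA hB, ← ENNReal.ofReal_add (by linarith) (by linarith)]
    simp⟩
  have hcoin : ∀ p ∈ Set.Icc (0 : ℝ) 1, IsProbabilityMeasure (coinLaw p) := fun p hp => ⟨by
    simp only [coinLaw, Measure.coe_add, Measure.coe_smul, Pi.add_apply, Pi.smul_apply,
      measure_univ, smul_eq_mul, mul_one]
    rw [← ENNReal.ofReal_add hp.1 (by linarith [hp.2])]
    simp⟩
  have hedge : ∀ (c : Fin N → Role) e, edgeProb peA peB peAB c e ∈ Set.Icc (0 : ℝ) 1 := by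
    intro c e
    unfold edgeProb
    split_ifs <;> first | assumption | simp
  have := fun c e => hcoin _ (hedge c e)
  refine ⟨?_⟩
  rw [linkGraphLaw, Measure.bind_apply MeasurableSet.univ (measurable_of_countable _).aemeasurable]
  have hmap : ∀ c : Fin N → Role, ((Measure.pi fun e : Sym2 (Fin N) =>
      coinLaw (edgeProb peA peB peAB c e)).map fun E => (c, E)) Set.univ = 1 := by
    intro c
    rw [Measure.map_apply (measurable_of_countable _) MeasurableSet.univ]
    simp
  simp [hmap]

/-! The sampled graph is almost surely bipartite, and each vertex misses only a small proportion of
the opposite part. For a complete bipartite graph with parts `S`, `Sᶜ`, the adjacency form is `2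
(∑_S y) (∑_{Sᶜ} y)`, which vanishes on the hyperplane `∑_S y = 0`. With at most `m` missing
neighbours per vertex it is at most `m ∑ y²` there, small against `∑ deg · y²`. By min-max, a bound
on one hyperplane controls the second smallest eigenvalue
(`spectralGapGT_of_almost_complete_bipartite`).

Write `q = n ^ (-α)` and `μ` for the expected size of a part, of order `n ^ (1 - dα)`, a positive
power of `n` because `α < 1/d`. Chernoff bounds put both part sizes between `μ/4` and `3μ`. Given
the roles, a vertex misses on average at most `3qμ` opposite points, so it misses `εμ` of them with
probability at most `exp(-εμ/2)`. A union bound over the vertices leaves an error of `(N + 4)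
exp(-εμ/2)`, which beats every power of `n`. -/

/-! ### Linear algebra: spectral gap of almost complete bipartite graphs -/

open Matrix in
/-- If the quadratic form of a Hermitian matrix exceeds `r` times the squared norm on a hyperplane,
then its second smallest eigenvalue exceeds `r`. -/
theorem Matrix.IsHermitian.lt_eigenvalues₀_of_hyperplane {V : Type*} [Fintype V] [DecidableEq V]
    {M : Matrix V V ℝ} (hM : M.IsHermitian) (h : 2 ≤ Fintype.card V) (r : ℝ) (φ : V → ℝ)
    (hφ : ∀ x : V → ℝ, x ≠ 0 → φ ⬝ᵥ x = 0 → r * (x ⬝ᵥ x) < x ⬝ᵥ (M *ᵥ x)) :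
    r < hM.eigenvalues₀ ⟨Fintype.card V - 2, by omega⟩ := by
  set e : Fin (Fintype.card V) ≃ V := Fintype.equivOfCardEq (Fintype.card_fin _) with he
  set k : Fin (Fintype.card V) := ⟨Fintype.card V - 2, by omega⟩ with hk
  set l : Fin (Fintype.card V) := ⟨Fintype.card V - 1, by omega⟩ with hl
  have hkl : k ≠ l := by simp [hk, hl]; omega
  have hle : hM.eigenvalues₀ l ≤ hM.eigenvalues₀ k :=
    hM.eigenvalues₀_antitone (by simp [hk, hl]; omega)
  have hev : ∀ i, hM.eigenvalues (e i) = hM.eigenvalues₀ i := fun i => by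
    simp [Matrix.IsHermitian.eigenvalues, he]
  have hinner : ∀ i j, (⇑(hM.eigenvectorBasis (e i)) : V → ℝ) ⬝ᵥ ⇑(hM.eigenvectorBasis (e j)) =
      if i = j then 1 else 0 := fun i j => by
    have := orthonormal_iff_ite.mp hM.eigenvectorBasis.orthonormal (e j) (e i)
    rw [EuclideanSpace.inner_eq_star_dotProduct] at this
    simpa [eq_comm] using this
  have hmul : ∀ i, M *ᵥ ⇑(hM.eigenvectorBasis (e i)) =
      hM.eigenvalues₀ i • (⇑(hM.eigenvectorBasis (e i)) : V → ℝ) := fun i => by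
    rw [hM.mulVec_eigenvectorBasis, hev]
  generalize hu : (⇑(hM.eigenvectorBasis (e k)) : V → ℝ) = u at *
  have hkk := hinner k k
  have hll := hinner l l
  have hkl' := hinner k l
  have hlk' := hinner l k
  have hmk := hmul k
  have hml := hmul l
  rw [hu] at hkk hkl' hlk' hmk
  generalize (⇑(hM.eigenvectorBasis (e l)) : V → ℝ) = w at *
  rw [if_pos rfl] at hkk hll
  rw [if_neg hkl] at hkl'
  rw [if_neg hkl.symm] at hlk'
  -- The span of the two bottom eigenvectors is two-dimensional, so it meets the hyperplane `φ = 0`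
  -- nontrivially.
  obtain ⟨a, b, hab, hzero⟩ : ∃ a b : ℝ, 0 < a ^ 2 + b ^ 2 ∧ a * (φ ⬝ᵥ u) + b * (φ ⬝ᵥ w) = 0 := by
    by_cases hw : φ ⬝ᵥ w = 0
    · exact ⟨0, 1, by norm_num, by simp [hw]⟩
    · exact ⟨φ ⬝ᵥ w, -(φ ⬝ᵥ u), by positivity, by ring⟩
  have hnorm : (a • u + b • w) ⬝ᵥ (a • u + b • w) = a ^ 2 + b ^ 2 := by
    simp only [add_dotProduct, dotProduct_add, smul_dotProduct, dotProduct_smul, hkk, hll, hkl',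
      hlk', smul_eq_mul]
    ring
  have hform : (a • u + b • w) ⬝ᵥ (M *ᵥ (a • u + b • w)) =
      hM.eigenvalues₀ k * a ^ 2 + hM.eigenvalues₀ l * b ^ 2 := by
    simp only [mulVec_add, mulVec_smul, hmk, hml, add_dotProduct, dotProduct_add, smul_dotProduct,
      dotProduct_smul, hkk, hll, hkl', hlk', smul_eq_mul]
    ring
  have hne : a • u + b • w ≠ 0 := by
    intro h0
    rw [h0] at hnorm
    simp at hnorm
    linarith
  have key := hφ _ hne (by simpa [dotProduct_add, dotProduct_smul] using hzero)
  rw [hnorm, hform] at key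
  by_contra hcon
  push Not at hcon
  nlinarith [sq_nonneg a, sq_nonneg b]

open Matrix Classical in
/-- The quadratic form of the normalized Laplacian after the substitution `y = D^(-1/2) x`. -/
theorem dotProduct_normalizedLaplacian_mulVec {V : Type*} [Fintype V] (G : SimpleGraph V)
    (x : V → ℝ) :
    x ⬝ᵥ (normalizedLaplacian G *ᵥ x) =
      ∑ v, (G.degree v : ℝ) * ((Real.sqrt (G.degree v))⁻¹ * x v) ^ 2 -
        ∑ u, ∑ v, if G.Adj u v then
          ((Real.sqrt (G.degree u))⁻¹ * x u) * ((Real.sqrt (G.degree v))⁻¹ * x v) else 0 := by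
  set y : V → ℝ := fun v => (Real.sqrt (G.degree v))⁻¹ * x v with hy
  have h1 : diagonal (fun v => (Real.sqrt (G.degree v))⁻¹) *ᵥ x = y := by
    ext v; simp [mulVec_diagonal, hy]
  have h2 : x ᵥ* diagonal (fun v => (Real.sqrt (G.degree v))⁻¹) = y := by
    ext v; simp [vecMul_diagonal, hy, mul_comm]
  have h3 : x ⬝ᵥ (normalizedLaplacian G *ᵥ x) = y ⬝ᵥ (G.lapMatrix ℝ *ᵥ y) := by
    rw [normalizedLaplacian, ← mulVec_mulVec, ← mulVec_mulVec, h1, dotProduct_mulVec, h2]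
  rw [h3, SimpleGraph.lapMatrix, sub_mulVec, dotProduct_sub,
    SimpleGraph.dotProduct_mulVec_degMatrix, SimpleGraph.dotProduct_mulVec_adjMatrix]
  congr 1
  exact Finset.sum_congr rfl fun v _ => by ring

open Matrix Classical in
/-- A bipartite graph with parts `S` and `Sᶜ` in which every vertex has at least `K` neighbours
and at most `m < δ K` non-neighbours in the opposite part has spectral gap larger than `1 - δ`. -/
theorem spectralGapGT_of_almost_complete_bipartite {V : Type*} [Fintype V] (G : SimpleGraph V)
    (S : Set V) {m K δ : ℝ} (hcard : 2 ≤ Fintype.card V) (hδ : 0 < δ) (hm : 0 ≤ m)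
    (hmK : m < δ * K) (hbip : ∀ u v, G.Adj u v → (u ∈ S ↔ v ∉ S))
    (hdeg : ∀ v, K ≤ G.degree v)
    (hmiss : ∀ u, ((Finset.univ.filter fun v => (u ∈ S ↔ v ∉ S) ∧ ¬ G.Adj u v).card : ℝ) ≤ m) :
    SpectralGapGT G (1 - δ) := by
  have hK : 0 < K := by
    by_contra hcon
    push Not at hcon
    nlinarith
  have hdpos : ∀ v, (0 : ℝ) < G.degree v := fun v => hK.trans_le (hdeg v)
  refine ⟨hcard, fun v hv => ?_, ?_⟩
  · have : 0 < G.degree v := by exact_mod_cast hdpos v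
    obtain ⟨w, hw⟩ := (G.degree_pos_iff_exists_adj v).mp this
    exact hv w hw
  rw [spectralGap, dif_pos hcard]
  -- In terms of `y = D^(-1/2) x`, orthogonality to this vector says that `y` sums to zero over `S`.
  refine (normalizedLaplacian_isHermitian G).lt_eigenvalues₀_of_hyperplane hcard _
    (fun v => if v ∈ S then (Real.sqrt (G.degree v))⁻¹ else 0) fun x hx horth => ?_
  rw [dotProduct_normalizedLaplacian_mulVec]
  set y : V → ℝ := fun v => (Real.sqrt (G.degree v))⁻¹ * x v with hy
  have hxy : ∀ v, x v * x v = G.degree v * y v ^ 2 := fun v => by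
    have := Real.sq_sqrt (hdpos v).le
    have hs : Real.sqrt (G.degree v) ≠ 0 := (Real.sqrt_pos.mpr (hdpos v)).ne'
    simp only [hy]
    rw [mul_pow, inv_pow, this]
    have := (hdpos v).ne'
    field_simp
  have hS : ∑ v, (if v ∈ S then y v else 0) = 0 := by
    refine (Finset.sum_congr rfl fun v _ => ?_).trans horth
    by_cases h : v ∈ S <;> simp [h, hy]
  have hxx : x ⬝ᵥ x = ∑ v, (G.degree v : ℝ) * y v ^ 2 :=
    Finset.sum_congr rfl fun v _ => hxy v
  have hypos : 0 < ∑ v, y v ^ 2 := by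
    obtain ⟨v, hv⟩ := Function.ne_iff.mp hx
    refine Finset.sum_pos' (fun v _ => sq_nonneg _) ⟨v, Finset.mem_univ v, ?_⟩
    have hv' : x v ≠ 0 := hv
    have : y v ≠ 0 := mul_ne_zero (inv_ne_zero (Real.sqrt_pos.mpr (hdpos v)).ne') hv'
    positivity
  have hKy : K * ∑ v, y v ^ 2 ≤ ∑ v, (G.degree v : ℝ) * y v ^ 2 := by
    rw [Finset.mul_sum]
    exact Finset.sum_le_sum fun v _ => mul_le_mul_of_nonneg_right (hdeg v) (sq_nonneg _)
  -- the non-adjacent opposite pairs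
  let b : V → V → ℝ := fun u v => if (u ∈ S ↔ v ∉ S) ∧ ¬ G.Adj u v then 1 else 0
  have hbsymm : ∀ u v, b u v = b v u := fun u v => by
    have : ((u ∈ S ↔ v ∉ S) ∧ ¬ G.Adj u v) ↔ ((v ∈ S ↔ u ∉ S) ∧ ¬ G.Adj v u) := by
      rw [G.adj_comm]; tauto
    simp only [b, this]
  have hb0 : ∀ u v, 0 ≤ b u v := fun u v => by simp only [b]; split_ifs <;> norm_num
  have hbsum : ∀ u, ∑ v, b u v ≤ m := fun u => by
    simpa [b, Finset.sum_boole] using hmiss u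
  have hopp : ∑ u, ∑ v, (if (u ∈ S ↔ v ∉ S) then y u * y v else 0) = 0 := by
    have hsplit : ∀ u v, (if (u ∈ S ↔ v ∉ S) then y u * y v else 0) =
        (if u ∈ S then y u else 0) * (if v ∈ S then 0 else y v) +
        (if u ∈ S then 0 else y u) * (if v ∈ S then y v else 0) := fun u v => by
      by_cases h1 : u ∈ S <;> by_cases h2 : v ∈ S <;> simp [h1, h2]
    simp only [hsplit, Finset.sum_add_distrib, ← Finset.mul_sum, ← Finset.sum_mul, hS]
    simp
  have hadj : ∀ u v, (if G.Adj u v then y u * y v else 0) =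
      (if (u ∈ S ↔ v ∉ S) then y u * y v else 0) - b u v * (y u * y v) := fun u v => by
    by_cases h1 : G.Adj u v
    · simp [b, h1, hbip u v h1]
    · by_cases h2 : (u ∈ S ↔ v ∉ S) <;> simp [b, h1, h2]
  have hbound : ∑ u, ∑ v, (if G.Adj u v then y u * y v else 0) ≤ m * ∑ v, y v ^ 2 := by
    have h1 : ∑ u, ∑ v, b u v * y u ^ 2 ≤ m * ∑ v, y v ^ 2 := by
      rw [Finset.mul_sum]
      refine Finset.sum_le_sum fun u _ => ?_
      rw [← Finset.sum_mul]
      exact mul_le_mul_of_nonneg_right (hbsum u) (sq_nonneg _)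
    have h2 : ∑ u, ∑ v, b u v * y v ^ 2 = ∑ u, ∑ v, b u v * y u ^ 2 := by
      rw [Finset.sum_comm]
      simp only [hbsymm]
    have h3 : ∑ u, ∑ v, (if G.Adj u v then y u * y v else 0) ≤
        ∑ u, ∑ v, ((if (u ∈ S ↔ v ∉ S) then y u * y v else 0) +
          (1 / 2 * (b u v * y u ^ 2) + 1 / 2 * (b u v * y v ^ 2))) := by
      refine Finset.sum_le_sum fun u _ => Finset.sum_le_sum fun v _ => ?_
      rw [hadj]
      -- This is `-y u * y v ≤ (y u ^ 2 + y v ^ 2) / 2`, weighted by `b u v`. By symmetry of `b`,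
      -- both squares then cost at most the row sum `m`.
      nlinarith [mul_nonneg (hb0 u v) (sq_nonneg (y u + y v))]
    simp only [Finset.sum_add_distrib, ← Finset.mul_sum] at h3
    simp only [hopp] at h3
    linarith
  have hfin : m * ∑ v, y v ^ 2 < δ * ∑ v, (G.degree v : ℝ) * y v ^ 2 := by
    have := mul_lt_mul_of_pos_right hmK hypos
    have := mul_le_mul_of_nonneg_left hKy hδ.le
    linarith
  rw [hxx]
  linarith

/-! ### Laws of a single role and a single coin -/

theorem isProbabilityMeasure_roleLaw {pA pB : ℝ} (hA : 0 ≤ pA) (hB : 0 ≤ pB) (hAB : pA + pB ≤ 1) :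
    IsProbabilityMeasure (roleLaw pA pB) := ⟨by
  simp only [roleLaw, Measure.coe_add, Measure.coe_smul, Pi.add_apply, Pi.smul_apply,
    measure_univ, smul_eq_mul, mul_one]
  rw [← ENNReal.ofReal_add hA hB, ← ENNReal.ofReal_add (by linarith) (by linarith)]
  simp⟩

theorem isProbabilityMeasure_coinLaw {p : ℝ} (hp : p ∈ Set.Icc (0 : ℝ) 1) :
    IsProbabilityMeasure (coinLaw p) := ⟨by
  simp only [coinLaw, Measure.coe_add, Measure.coe_smul, Pi.add_apply, Pi.smul_apply,
    measure_univ, smul_eq_mul, mul_one]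
  rw [← ENNReal.ofReal_add hp.1 (by linarith [hp.2])]
  simp⟩

theorem roleLaw_real_A {pA pB : ℝ} (hA : 0 ≤ pA) : (roleLaw pA pB).real {Role.A} = pA := by
  simp [Measure.real, roleLaw, hA]

theorem roleLaw_real_B {pA pB : ℝ} (hB : 0 ≤ pB) : (roleLaw pA pB).real {Role.B} = pB := by
  simp [Measure.real, roleLaw, hB]

theorem coinLaw_real_false {p : ℝ} (hp : p ≤ 1) : (coinLaw p).real {false} = 1 - p := by
  simp [Measure.real, coinLaw, hp]

theorem coinLaw_zero_true : (coinLaw 0) {true} = 0 := by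
  simp [coinLaw]

theorem edgeProb_mem_Icc {N : ℕ} {peA peB peAB : ℝ} (h1 : peA ∈ Set.Icc (0 : ℝ) 1)
    (h2 : peB ∈ Set.Icc (0 : ℝ) 1) (h3 : peAB ∈ Set.Icc (0 : ℝ) 1) (c : Fin N → Role)
    (e : Sym2 (Fin N)) : edgeProb peA peB peAB c e ∈ Set.Icc (0 : ℝ) 1 := by
  unfold edgeProb
  split_ifs <;> first | assumption | simp

/-! ### Chernoff bounds for counts of independent events -/

section Chernoff

variable {ι Ω : Type*} [Fintype ι] [Finite Ω] [MeasurableSpace Ω] [DiscreteMeasurableSpace Ω]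

open Classical in
/-- The number of coordinates `i` of `x` that lie in `S i`. -/
noncomputable def hitCount (S : ι → Set Ω) (x : ι → Ω) : ℝ :=
  ((Finset.univ.filter fun i => x i ∈ S i).card : ℝ)

-- The exponential of the count is a product of independent factors with means `1 + (e^t - 1) P i (S
-- i)`, and `1 + z ≤ e^z` bounds each of them.
open Classical in
theorem mgf_hitCount_le (P : ι → Measure Ω) [∀ i, IsProbabilityMeasure (P i)] (S : ι → Set Ω)
    (t : ℝ) :
    ProbabilityTheory.mgf (hitCount S) (Measure.pi P) t ≤
      Real.exp ((Real.exp t - 1) * ∑ i, (P i).real (S i)) := by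
  have h1 : ∀ x : ι → Ω, Real.exp (t * hitCount S x) =
      ∏ i, (1 + (S i).indicator (fun _ => Real.exp t - 1) (x i)) := fun x => by
    rw [hitCount, mul_comm, Real.exp_nat_mul, ← Finset.prod_const, Finset.prod_filter]
    refine Finset.prod_congr rfl fun i _ => ?_
    by_cases h : x i ∈ S i <;> simp [h]
  have h2 : ∀ i, ∫ a, (1 + (S i).indicator (fun _ => Real.exp t - 1) a) ∂(P i) =
      1 + (Real.exp t - 1) * (P i).real (S i) := fun i => by
    rw [integral_add (Integrable.of_finite) (Integrable.of_finite),
      integral_indicator_const _ (MeasurableSet.of_discrete)]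
    simp [mul_comm]
  rw [ProbabilityTheory.mgf]
  simp only [h1]
  rw [integral_fintype_prod_eq_prod (fun i a => 1 + (S i).indicator (fun _ => Real.exp t - 1) a)]
  simp only [h2]
  rw [Finset.mul_sum, Real.exp_sum]
  refine Finset.prod_le_prod (fun i _ => ?_) fun i _ => ?_
  · have h3 := measureReal_le_one (μ := P i) (s := S i)
    have h4 := measureReal_nonneg (μ := P i) (s := S i)
    nlinarith [Real.exp_pos t]
  · linarith [Real.add_one_le_exp ((Real.exp t - 1) * (P i).real (S i))]

/-- Exponential Markov inequality at `t = 1`, with `e - 1 ≤ 2`. -/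
theorem measureReal_le_hitCount (P : ι → Measure Ω) [∀ i, IsProbabilityMeasure (P i)]
    (S : ι → Set Ω) (m : ℝ) :
    (Measure.pi P).real {x | m ≤ hitCount S x} ≤ Real.exp (2 * ∑ i, (P i).real (S i) - m) := by
  have h0 : 0 ≤ ∑ i, (P i).real (S i) := Finset.sum_nonneg fun _ _ => measureReal_nonneg
  have h1 := ProbabilityTheory.measure_ge_le_exp_mul_mgf (μ := Measure.pi P) (X := hitCount S)
    (t := 1) m zero_le_one Integrable.of_finite
  refine h1.trans ((mul_le_mul_of_nonneg_left (mgf_hitCount_le P S 1) (Real.exp_pos _).le).trans ?_)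
  rw [← Real.exp_add]
  have := Real.exp_one_lt_d9
  exact Real.exp_le_exp.mpr (by nlinarith)

/-- Exponential Markov inequality at `t = -1`, with `e⁻¹ - 1 ≤ -1/2`. -/
theorem measureReal_hitCount_le (P : ι → Measure Ω) [∀ i, IsProbabilityMeasure (P i)]
    (S : ι → Set Ω) (m : ℝ) :
    (Measure.pi P).real {x | hitCount S x ≤ m} ≤ Real.exp (m - (∑ i, (P i).real (S i)) / 2) := by
  have h0 : 0 ≤ ∑ i, (P i).real (S i) := Finset.sum_nonneg fun _ _ => measureReal_nonneg
  have h1 := ProbabilityTheory.measure_le_le_exp_mul_mgf (μ := Measure.pi P) (X := hitCount S)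
    (t := -1) m (by norm_num) Integrable.of_finite
  refine h1.trans ((mul_le_mul_of_nonneg_left (mgf_hitCount_le P S (-1))
    (Real.exp_pos _).le).trans ?_)
  rw [← Real.exp_add]
  have h2 : Real.exp (-1) ≤ 1 / 2 := by
    rw [Real.exp_neg, inv_le_comm₀ (Real.exp_pos _) (by norm_num)]
    linarith [Real.exp_one_gt_d9]
  exact Real.exp_le_exp.mpr (by nlinarith)

end Chernoff

/-! ### Conditioning on the roles, and the deterministic criterion -/

/-- Probabilities in the random graph model, by conditioning on the roles. -/
theorem linkGraphLaw_real_le {N : ℕ} {pA pB peA peB peAB : ℝ}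
    (hA : 0 ≤ pA) (hB : 0 ≤ pB) (hAB : pA + pB ≤ 1)
    (h1 : peA ∈ Set.Icc (0 : ℝ) 1) (h2 : peB ∈ Set.Icc (0 : ℝ) 1)
    (h3 : peAB ∈ Set.Icc (0 : ℝ) 1)
    (s : Set ((Fin N → Role) × (Sym2 (Fin N) → Bool))) (T : Set (Fin N → Role)) {ε : ℝ} (hε : 0 ≤ ε)
    (hT : ∀ c ∉ T, (Measure.pi fun e : Sym2 (Fin N) => coinLaw (edgeProb peA peB peAB c e)).real
      {E | (c, E) ∈ s} ≤ ε) :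
    (linkGraphLaw N pA pB peA peB peAB).real s ≤
      (Measure.pi fun _ : Fin N => roleLaw pA pB).real T + ε := by
  have := isProbabilityMeasure_roleLaw hA hB hAB
  have hcoin : ∀ (c : Fin N → Role) e, IsProbabilityMeasure (coinLaw (edgeProb peA peB peAB c e)) :=
    fun c e => isProbabilityMeasure_coinLaw (edgeProb_mem_Icc h1 h2 h3 c e)
  have hs : MeasurableSet s := MeasurableSet.of_discrete
  have hle : (linkGraphLaw N pA pB peA peB peAB) s ≤
      (Measure.pi fun _ : Fin N => roleLaw pA pB) T + ENNReal.ofReal ε := by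
    rw [linkGraphLaw, Measure.bind_apply hs (measurable_of_countable _).aemeasurable]
    calc _ ≤ ∫⁻ c, (T.indicator 1 c + ENNReal.ofReal ε)
          ∂(Measure.pi fun _ : Fin N => roleLaw pA pB) := by
          refine lintegral_mono fun c => ?_
          rw [Measure.map_apply (measurable_of_countable _) hs]
          by_cases hc : c ∈ T
          · simp only [hc, Set.indicator_of_mem, Pi.one_apply]
            exact prob_le_one.trans le_self_add
          · simp only [hc, not_false_eq_true, Set.indicator_of_notMem, zero_add]
            rw [← ofReal_measureReal]
            exact ENNReal.ofReal_le_ofReal (hT c hc)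
      _ = _ := by
          rw [lintegral_add_right _ measurable_const, lintegral_indicator_one
            MeasurableSet.of_discrete]
          simp
  have := ENNReal.toReal_mono (by finiteness) hle
  rwa [ENNReal.toReal_add (by finiteness) (by finiteness), ENNReal.toReal_ofReal hε] at this

theorem edgeProb_bipartite {N : ℕ} (p : ℝ) (c : Fin N → Role) (e : Sym2 (Fin N)) :
    edgeProb 0 0 p c e = if e.map c = s(Role.A, Role.B) then p else 0 := by
  unfold edgeProb
  by_cases h1 : e.map c = s(Role.A, Role.A)
  · simp [h1]
  by_cases h2 : e.map c = s(Role.B, Role.B)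
  · simp [h2]
  simp [h1, h2]

theorem role_pair_eq_iff {a b : Role} (ha : a ≠ Role.out) (hb : b ≠ Role.out) :
    s(a, b) = s(Role.A, Role.B) ↔ (a = Role.A ↔ b ≠ Role.A) := by
  cases a <;> cases b <;> simp_all

/-- The points in the part opposite to that of `v`. -/
def oppositePart {N : ℕ} (c : Fin N → Role) (v : Fin N) : Finset (Fin N) :=
  Finset.univ.filter fun w => s(c v, c w) = s(Role.A, Role.B)

/-- The points in the part opposite to that of `v` that are not joined to `v`. -/
def missingNeighbors {N : ℕ} (c : Fin N → Role) (E : Sym2 (Fin N) → Bool) (v : Fin N) :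
    Finset (Fin N) :=
  Finset.univ.filter fun w => s(c v, c w) = s(Role.A, Role.B) ∧ E s(v, w) = false

theorem oppositePart_card_A {N : ℕ} {c : Fin N → Role} {v : Fin N} (hv : c v = Role.A) :
    ((oppositePart c v).card : ℝ) = hitCount (fun _ => {Role.B}) c := by
  rw [oppositePart, hitCount]
  congr 2
  ext w
  simp [hv]

theorem oppositePart_card_B {N : ℕ} {c : Fin N → Role} {v : Fin N} (hv : c v = Role.B) :
    ((oppositePart c v).card : ℝ) = hitCount (fun _ => {Role.A}) c := by
  rw [oppositePart, hitCount]
  congr 2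
  ext w
  simp [hv]

theorem oppositePart_card_out {N : ℕ} {c : Fin N → Role} {v : Fin N} (hv : c v = Role.out) :
    (oppositePart c v).card = 0 := by
  simp [oppositePart, hv]

theorem exists_eq_of_hitCount_pos {N : ℕ} {c : Fin N → Role} {r : Role}
    (h : 0 < hitCount (fun _ => {r}) c) : ∃ v, c v = r := by
  classical
  rw [hitCount, Nat.cast_pos, Finset.card_pos] at h
  obtain ⟨v, hv⟩ := h
  exact ⟨v, by simpa using hv⟩

/-- Deterministic conditions on an outcome that force a large spectral gap. -/
theorem spectralGapGT_sampledGraph {N : ℕ} (c : Fin N → Role) (E : Sym2 (Fin N) → Bool)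
    {m M δ : ℝ} (hδ : 0 < δ) (hm : 0 ≤ m) (hM : 0 < M) (hmM : m < δ * (M - m))
    (hA : M ≤ hitCount (fun _ => {Role.A}) c) (hB : M ≤ hitCount (fun _ => {Role.B}) c)
    (hE : ∀ e, e.map c ≠ s(Role.A, Role.B) → E e = false)
    (hmiss : ∀ v, ((missingNeighbors c E v).card : ℝ) ≤ m) :
    SpectralGapGT (sampledGraph (c, E)) (1 - δ) := by
  classical
  have hadj : ∀ u v, (sampledGraph (c, E)).Adj u v ↔ E s(u.1, v.1) = true ∧ u.1 ≠ v.1 := by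
    intro u v
    simp [sampledGraph]
  obtain ⟨a, ha⟩ := exists_eq_of_hitCount_pos (hM.trans_le hA)
  obtain ⟨b, hb⟩ := exists_eq_of_hitCount_pos (hM.trans_le hB)
  have hopp : ∀ u v : {v : Fin N // c v ≠ Role.out}, s(c u, c v) = s(Role.A, Role.B) ↔
      (u ∈ {v : {v : Fin N // c v ≠ Role.out} | c v.1 = Role.A} ↔
        v ∉ {v : {v : Fin N // c v ≠ Role.out} | c v.1 = Role.A}) :=
    fun u v => role_pair_eq_iff u.2 v.2
  have hmiss' : ∀ u : {v : Fin N // c v ≠ Role.out}, ((Finset.univ.filter fun v =>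
      s(c u, c v.1) = s(Role.A, Role.B) ∧ ¬ (sampledGraph (c, E)).Adj u v).card : ℝ) ≤ m := by
    intro u
    refine le_trans (Nat.cast_le.mpr ?_) (hmiss u.1)
    refine Finset.card_le_card_of_injOn Subtype.val (fun v hv => ?_) Subtype.val_injective.injOn
    simp only [Finset.coe_filter, Finset.mem_univ, true_and, Set.mem_ofPred_eq, hadj] at hv
    -- Loops are discarded from the graph, so non-adjacency gives `E s(u, v) = false` only for
    -- distinct points; a point is never opposite to itself.
    have hne : u.1 ≠ v.1 := fun h => by
      have := hv.1
      rw [h, role_pair_eq_iff v.2 v.2] at this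
      tauto
    simpa [missingNeighbors, hne] using hv
  refine spectralGapGT_of_almost_complete_bipartite (sampledGraph (c, E))
    {v : {v : Fin N // c v ≠ Role.out} | c v.1 = Role.A} (m := m) (K := M - m) ?_ hδ hm hmM ?_ ?_ ?_
  · have : Nontrivial {v : Fin N // c v ≠ Role.out} :=
      ⟨⟨a, by simp [ha]⟩, ⟨b, by simp [hb]⟩, fun h => by
        have := congrArg (fun v => c v.1) h
        simp [ha, hb] at this⟩
    exact Fintype.one_lt_card
  · intro u v huv
    rw [← hopp]
    by_contra hne
    have := hE s(u.1, v.1) hne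
    rw [hadj] at huv
    simp [this] at huv
  · intro v
    have hdeg : (sampledGraph (c, E)).degree v =
        (Finset.univ.filter fun w => (sampledGraph (c, E)).Adj v w).card := by
      rw [← SimpleGraph.card_neighborFinset_eq_degree, SimpleGraph.neighborFinset_eq_filter]
    have hM' : M ≤ (oppositePart c v.1).card := by
      rcases hc : c v.1 with _ | _ | _
      · rwa [oppositePart_card_A hc]
      · rwa [oppositePart_card_B hc]
      · exact absurd hc v.2
    -- Every opposite point is either a neighbour or missing, so the degree is at least `M - m`.
    have hsub : (oppositePart c v.1).card ≤
        (Finset.univ.filter fun w : {v : Fin N // c v ≠ Role.out} =>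
          s(c v, c w.1) = s(Role.A, Role.B) ∧ ¬ (sampledGraph (c, E)).Adj v w).card +
        (Finset.univ.filter fun w => (sampledGraph (c, E)).Adj v w).card := by
      refine le_trans ?_ (Finset.card_union_le _ _)
      rw [← Finset.card_map (Function.Embedding.subtype _)]
      refine Finset.card_le_card fun w hw => ?_
      have hw' : s(c v.1, c w) = s(Role.A, Role.B) := by simpa [oppositePart] using hw
      have hwo : c w ≠ Role.out := fun h => by
        rw [h] at hw'
        simp at hw'
      simp only [Finset.mem_map, Finset.mem_union, Finset.mem_filter, Finset.mem_univ, true_and]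
      exact ⟨⟨w, hwo⟩, by tauto, rfl⟩
    have h1 := hmiss' v
    have h2 : ((oppositePart c v.1).card : ℝ) ≤ _ := Nat.cast_le.mpr hsub
    rw [Nat.cast_add, ← hdeg] at h2
    have h3 : ((sampledGraph (c, E)).degree v : ℝ) ≥ M - m := by linarith
    convert h3
  · intro u
    simp only [← hopp]
    convert hmiss' u

/-! ### Failure probabilities -/

/-- Given the roles, a vertex is unlikely to miss many vertices of the opposite part. -/
theorem measureReal_missingNeighbors {N : ℕ} {q : ℝ} (hq : q ∈ Set.Icc (0 : ℝ) 1)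
    (c : Fin N → Role) (v : Fin N) (m : ℝ) :
    (Measure.pi fun e : Sym2 (Fin N) => coinLaw (edgeProb 0 0 (1 - q) c e)).real
      {E | m ≤ (missingNeighbors c E v).card} ≤
      Real.exp (2 * (q * (oppositePart c v).card) - m) := by
  classical
  have hq' : 1 - q ∈ Set.Icc (0 : ℝ) 1 := ⟨by linarith [hq.2], by linarith [hq.1]⟩
  have hcoin : ∀ e, IsProbabilityMeasure (coinLaw (edgeProb 0 0 (1 - q) c e)) := fun e =>
    isProbabilityMeasure_coinLaw (edgeProb_mem_Icc (by simp) (by simp) hq' c e)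
  -- Missing neighbours are counted through the independent coins of the pairs `s(v, w)`; the empty
  -- set silences all other coins.
  let S : Sym2 (Fin N) → Set Bool := fun e =>
    if e ∈ (oppositePart c v).image (fun w => s(v, w)) then {false} else ∅
  have hcount : ∀ E, ((missingNeighbors c E v).card : ℝ) ≤ hitCount S E := by
    intro E
    rw [hitCount, Nat.cast_le]
    refine Finset.card_le_card_of_injOn (fun w => s(v, w)) (fun w hw => ?_)
      (fun w _ w' _ h => Sym2.congr_right.mp h)
    have hw' : s(c v, c w) = s(Role.A, Role.B) ∧ E s(v, w) = false := by
      simpa [missingNeighbors] using hw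
    have hmem : s(v, w) ∈ (oppositePart c v).image (fun w => s(v, w)) :=
      Finset.mem_image_of_mem _ (Finset.mem_filter.mpr ⟨Finset.mem_univ w, hw'.1⟩)
    simp only [Finset.coe_filter, Finset.mem_univ, true_and, Set.mem_ofPred_eq, S]
    rw [if_pos hmem]
    exact hw'.2
  have hsum : ∑ e, (coinLaw (edgeProb 0 0 (1 - q) c e)).real (S e) ≤
      q * (oppositePart c v).card := by
    have : ∀ e, (coinLaw (edgeProb 0 0 (1 - q) c e)).real (S e) =
        if e ∈ (oppositePart c v).image (fun w => s(v, w)) then q else 0 := by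
      intro e
      simp only [S]
      split_ifs with he
      · obtain ⟨w, hw, rfl⟩ := Finset.mem_image.mp he
        have hw' : s(c v, c w) = s(Role.A, Role.B) := by simpa [oppositePart] using hw
        rw [edgeProb_bipartite, Sym2.map_mk, if_pos hw', coinLaw_real_false hq'.2]
        ring
      · simp
    simp only [this]
    rw [Finset.sum_ite_mem, Finset.univ_inter, Finset.sum_const, nsmul_eq_mul, mul_comm]
    exact mul_le_mul_of_nonneg_left (Nat.cast_le.mpr Finset.card_image_le) hq.1
  refine (measureReal_mono fun E hE => ?_).trans ((measureReal_le_hitCount _ S m).trans ?_)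
  · exact le_trans (show m ≤ _ from hE) (hcount E)
  · exact Real.exp_le_exp.mpr (by linarith)

/-- Given the roles, almost surely all edges run between the two parts. -/
theorem measureReal_edge_inside_part {N : ℕ} {p : ℝ} (hp : p ∈ Set.Icc (0 : ℝ) 1)
    (c : Fin N → Role) :
    (Measure.pi fun e : Sym2 (Fin N) => coinLaw (edgeProb 0 0 p c e)).real
      {E | ∃ e, e.map c ≠ s(Role.A, Role.B) ∧ E e = true} = 0 := by
  have hcoin : ∀ e, IsProbabilityMeasure (coinLaw (edgeProb 0 0 p c e)) := fun e =>
    isProbabilityMeasure_coinLaw (edgeProb_mem_Icc (by simp) (by simp) hp c e)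
  rw [measureReal_eq_zero_iff]
  have : {E : Sym2 (Fin N) → Bool | ∃ e, e.map c ≠ s(Role.A, Role.B) ∧ E e = true} =
      ⋃ e, {E | e.map c ≠ s(Role.A, Role.B) ∧ E e = true} := by
    ext E; simp
  rw [this, measure_iUnion_null_iff]
  intro e
  by_cases he : e.map c = s(Role.A, Role.B)
  · simp [he]
  · have h := (measurePreserving_eval (fun e : Sym2 (Fin N) => coinLaw (edgeProb 0 0 p c e))
      e).measure_preimage (s := {true}) (MeasurableSet.of_discrete.nullMeasurableSet)
    rw [edgeProb_bipartite, if_neg he, coinLaw_zero_true] at h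
    refine measure_mono_null (fun E hE => ?_) h
    exact hE.2

/-- Quantitative bound on the probability that the spectral gap is not large. -/
theorem one_sub_le_linkGraphLaw_real_spectralGapGT {N : ℕ} {p q ε δ : ℝ} (hp : 0 < p)
    (hp' : p + p ≤ 1) (hq : q ∈ Set.Icc (0 : ℝ) 1) (hN : 0 < N) (hδ : 0 < δ) (hε : 0 < ε)
    (hε1 : ε ≤ 1 / 16) (hεδ : ε ≤ δ / 16) (hqε : 12 * q ≤ ε) :
    1 - (N + 4) * Real.exp (-(ε / 2 * (N * p))) ≤
      (linkGraphLaw N p p 0 0 (1 - q)).real {ω | SpectralGapGT (sampledGraph ω) (1 - δ)} := by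
  classical
  have hq' : 1 - q ∈ Set.Icc (0 : ℝ) 1 := ⟨by linarith [hq.2], by linarith [hq.1]⟩
  have hz : (0 : ℝ) ∈ Set.Icc (0 : ℝ) 1 := by simp
  have hprob := isProbabilityMeasure_linkGraphLaw N hp.le hp.le hp' hz hz hq'
  have hrole := isProbabilityMeasure_roleLaw hp.le hp.le hp'
  have hcoin : ∀ (c : Fin N → Role) e, IsProbabilityMeasure (coinLaw (edgeProb 0 0 (1 - q) c e)) :=
    fun c e => isProbabilityMeasure_coinLaw (edgeProb_mem_Icc hz hz hq' c e)
  set μ : ℝ := N * p with hμ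
  have hμ0 : 0 < μ := mul_pos (Nat.cast_pos.mpr hN) hp
  -- Atypical part sizes. The Chernoff exponents at these thresholds are `-μ/4` and `-μ`, both below
  -- `-εμ/2`.
  let T : Role → Set (Fin N → Role) := fun r =>
    {c | hitCount (fun _ => {r}) c ≤ μ / 4} ∪ {c | 3 * μ ≤ hitCount (fun _ => {r}) c}
  have hTr : ∀ r, (roleLaw p p).real {r} = p →
      (Measure.pi fun _ : Fin N => roleLaw p p).real (T r) ≤ 2 * Real.exp (-(ε / 2 * μ)) := by
    intro r hr
    have hsum : ∑ _i : Fin N, (roleLaw p p).real {r} = μ := by simp [hr, hμ]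
    have h1 := measureReal_hitCount_le (fun _ : Fin N => roleLaw p p) (fun _ => {r}) (μ / 4)
    have h2 := measureReal_le_hitCount (fun _ : Fin N => roleLaw p p) (fun _ => {r}) (3 * μ)
    rw [hsum] at h1 h2
    have h3 : Real.exp (μ / 4 - μ / 2) ≤ Real.exp (-(ε / 2 * μ)) :=
      Real.exp_le_exp.mpr (by nlinarith)
    have h4 : Real.exp (2 * μ - 3 * μ) ≤ Real.exp (-(ε / 2 * μ)) :=
      Real.exp_le_exp.mpr (by nlinarith)
    refine (measureReal_union_le _ _).trans ?_
    linarith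
  have hbad : (linkGraphLaw N p p 0 0 (1 - q)).real
      {ω | SpectralGapGT (sampledGraph ω) (1 - δ)}ᶜ ≤
      (Measure.pi fun _ : Fin N => roleLaw p p).real (T Role.A ∪ T Role.B) +
        N * Real.exp (-(ε / 2 * μ)) := by
    refine linkGraphLaw_real_le hp.le hp.le hp' hz hz hq' _ _ (by positivity) fun c hc => ?_
    simp only [T, Set.mem_union, Set.mem_ofPred_eq, not_or, not_le] at hc
    have hsub : {E | (c, E) ∈ {ω : (Fin N → Role) × (Sym2 (Fin N) → Bool) |
        SpectralGapGT (sampledGraph ω) (1 - δ)}ᶜ} ⊆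
        (⋃ v, {E | ε * μ ≤ (missingNeighbors c E v).card}) ∪
          {E | ∃ e, e.map c ≠ s(Role.A, Role.B) ∧ E e = true} := by
      intro E hE
      by_contra hcon
      simp only [Set.mem_union, Set.mem_iUnion, Set.mem_ofPred_eq, not_or, not_exists, not_le,
        not_and, Bool.not_eq_true] at hcon
      refine hE (spectralGapGT_sampledGraph c E (m := ε * μ) (M := μ / 4) hδ (by positivity)
        (by positivity) ?_ hc.1.1.le hc.2.1.le hcon.2 fun v => (hcon.1 v).le)
      -- Both `εμ` and `δεμ` are at most `δμ/16`, hence `εμ < δ (μ/4 - εμ)`.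
      nlinarith [mul_pos hδ hμ0, mul_le_mul_of_nonneg_right hεδ hμ0.le,
        mul_le_mul_of_nonneg_right hε1 (mul_pos hδ hμ0).le]
    refine (measureReal_mono hsub).trans ((measureReal_union_le _ _).trans ?_)
    rw [measureReal_edge_inside_part hq' c, add_zero]
    refine (measureReal_iUnion_fintype_le _).trans ?_
    refine (Finset.sum_le_card_nsmul _ _ (Real.exp (-(ε / 2 * μ))) fun v _ => ?_).trans (by simp)
    refine (measureReal_missingNeighbors hq c v _).trans (Real.exp_le_exp.mpr ?_)
    have hopp : ((oppositePart c v).card : ℝ) ≤ 3 * μ := by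
      rcases hv : c v with _ | _ | _
      · rw [oppositePart_card_A hv]; exact hc.2.2.le
      · rw [oppositePart_card_B hv]; exact hc.1.2.le
      · rw [oppositePart_card_out hv]; simp; positivity
    -- Twice the mean is at most `6qμ ≤ εμ/2`, which is where `12 * q ≤ ε` enters.
    nlinarith [mul_le_mul_of_nonneg_left hopp hq.1, mul_le_mul_of_nonneg_right hqε hμ0.le]
  rw [probReal_compl_eq_one_sub MeasurableSet.of_discrete] at hbad
  -- Two tails for each of the two parts account for the `4` in `N + 4`.
  have hT := (measureReal_union_le (μ := Measure.pi fun _ : Fin N => roleLaw p p)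
    (T Role.A) (T Role.B))
  have h1 := hTr _ (roleLaw_real_A hp.le)
  have h2 := hTr _ (roleLaw_real_B hp.le)
  linarith

/-! ### Asymptotics in `n` -/

/-- The exponent `w` is chosen so that `n ^ (-w n) = n² exp(-κ n^β)`; the factor `n²` absorbs `n +
4` for `n ≥ 3`, and `w` diverges because `log n = o(n^β)`. -/
theorem withOverwhelmingProbability_of_exp_bound {P : ℕ → ℝ} {κ β : ℝ} (hκ : 0 < κ) (hβ : 0 < β)
    (hP : ∀ᶠ n : ℕ in atTop, 1 - ((n : ℝ) + 4) * Real.exp (-(κ * (n : ℝ) ^ β)) ≤ P n) :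
    WithOverwhelmingProbability P := by
  refine ⟨fun n => κ * ((n : ℝ) ^ β / Real.log n) - 2, ?_, ?_⟩
  · have h1 : Tendsto (fun x : ℝ => x ^ β / Real.log x) atTop atTop := by
      have h := (isLittleO_log_rpow_atTop hβ).tendsto_div_nhds_zero
      have h' : Tendsto (fun x : ℝ => Real.log x / x ^ β) atTop (𝓝[>] 0) := by
        refine tendsto_nhdsWithin_iff.mpr ⟨h, ?_⟩
        filter_upwards [eventually_gt_atTop 1] with x hx
        exact div_pos (Real.log_pos hx) (Real.rpow_pos_of_pos (by linarith) _)
      refine (tendsto_inv_nhdsGT_zero.comp h').congr fun x => ?_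
      simp
    exact tendsto_atTop_add_const_right _ _
      ((h1.comp tendsto_natCast_atTop_atTop).const_mul_atTop hκ)
  · filter_upwards [hP, eventually_ge_atTop 3] with n hn h3
    refine le_trans ?_ hn
    have h3' : (3 : ℝ) ≤ n := by exact_mod_cast h3
    have hn0 : (0 : ℝ) < n := by linarith
    have hlog : 0 < Real.log n := Real.log_pos (by linarith)
    have : (n : ℝ) ^ (-(κ * ((n : ℝ) ^ β / Real.log n) - 2)) =
        (n : ℝ) ^ 2 * Real.exp (-(κ * (n : ℝ) ^ β)) := by
      rw [Real.rpow_def_of_pos hn0]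
      have : Real.log n * (-(κ * ((n : ℝ) ^ β / Real.log n) - 2)) =
          ((2 : ℕ) : ℝ) * Real.log n + -(κ * (n : ℝ) ^ β) := by
        field_simp
        push_cast
        ring
      rw [this, Real.exp_add, Real.exp_nat_mul, Real.exp_log hn0]
    rw [this]
    have := mul_le_mul_of_nonneg_right (show (n : ℝ) + 4 ≤ (n : ℝ) ^ 2 by nlinarith)
      (Real.exp_pos (-(κ * (n : ℝ) ^ β))).le
    linarith

theorem mainTheorem11 (d : ℕ) (hd : 1 ≤ d) (α : ℝ) (hα : 0 < α) (hαd : α < 1 / (d : ℝ))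
    (δ : ℝ) (hδ : 0 < δ) :
    WithOverwhelmingProbability fun n : ℕ =>
      (linkGraphLaw (n - 2 * d)
        ((n : ℝ) ^ (-((d : ℝ) * α)) * (1 - (n : ℝ) ^ (-α)) ^ d)
        ((n : ℝ) ^ (-((d : ℝ) * α)) * (1 - (n : ℝ) ^ (-α)) ^ d)
        0 0 (1 - (n : ℝ) ^ (-α))).real
        {ω | SpectralGapGT (sampledGraph ω) (1 - δ)} := by
  have hd0 : (0 : ℝ) < d := by exact_mod_cast hd
  have hdα : 0 < (d : ℝ) * α := mul_pos hd0 hα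
  have hβ : 0 < 1 - (d : ℝ) * α := by
    have := (lt_div_iff₀ hd0).mp hαd
    linarith
  set ε : ℝ := min 1 δ / 16 with hε
  have hε0 : 0 < ε := by positivity
  have hq : Tendsto (fun n : ℕ => (n : ℝ) ^ (-α)) atTop (𝓝 0) :=
    (tendsto_rpow_neg_atTop hα).comp tendsto_natCast_atTop_atTop
  have hr : Tendsto (fun n : ℕ => (n : ℝ) ^ (-((d : ℝ) * α))) atTop (𝓝 0) :=
    (tendsto_rpow_neg_atTop hdα).comp tendsto_natCast_atTop_atTop
  -- In `κ`, one factor `1/2` comes from `n - 2d ≥ n/2`, and `d` more from `1 - q ≥ 1/2`.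
  refine withOverwhelmingProbability_of_exp_bound
    (κ := ε / 2 * (1 / 2) ^ (d + 1)) (β := 1 - (d : ℝ) * α) (by positivity) hβ ?_
  filter_upwards [hq.eventually (ge_mem_nhds (show (0 : ℝ) < ε / 12 by positivity)),
    hr.eventually (ge_mem_nhds (show (0 : ℝ) < 1 / 2 by positivity)),
    eventually_ge_atTop (4 * d)] with n hqn hrn hn
  have hn0 : (0 : ℝ) < n := by exact_mod_cast (show 0 < n by omega)
  have hε1 : ε ≤ 1 / 16 := by rw [hε]; gcongr; exact min_le_left _ _
  have hεδ : ε ≤ δ / 16 := by rw [hε]; gcongr; exact min_le_right _ _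
  set q : ℝ := (n : ℝ) ^ (-α) with hqdef
  set r : ℝ := (n : ℝ) ^ (-((d : ℝ) * α)) with hrdef
  have hq0 : 0 < q := Real.rpow_pos_of_pos hn0 _
  have hr0 : 0 < r := Real.rpow_pos_of_pos hn0 _
  have hpow_le : (1 - q) ^ d ≤ 1 := pow_le_one₀ (by linarith) (by linarith)
  have hpow_ge : (1 / 2 : ℝ) ^ d ≤ (1 - q) ^ d :=
    pow_le_pow_left₀ (by norm_num) (by linarith) d
  have hpow_pos : 0 < (1 - q) ^ d := pow_pos (by linarith) d
  have hp : 0 < r * (1 - q) ^ d := mul_pos hr0 hpow_pos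
  -- The two role probabilities sum to at most `1` since `r ≤ 1/2`.
  have hp' : r * (1 - q) ^ d + r * (1 - q) ^ d ≤ 1 := by nlinarith
  have hN : 0 < n - 2 * d := by omega
  refine le_trans ?_ (one_sub_le_linkGraphLaw_real_spectralGapGT (ε := ε) (δ := δ) hp hp'
    ⟨hq0.le, by linarith⟩ hN hδ hε0 hε1 hεδ (by linarith))
  have hNle : ((n - 2 * d : ℕ) : ℝ) ≤ n := by exact_mod_cast Nat.sub_le _ _
  have hNge : (n : ℝ) / 2 ≤ ((n - 2 * d : ℕ) : ℝ) := by
    have : n ≤ 2 * (n - 2 * d) := by omega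
    have : (n : ℝ) ≤ 2 * ((n - 2 * d : ℕ) : ℝ) := by exact_mod_cast this
    linarith
  have hnr : (n : ℝ) ^ (1 - (d : ℝ) * α) = n * r := by
    rw [hrdef, sub_eq_add_neg, Real.rpow_add hn0, Real.rpow_one]
  have hmean : (1 / 2) ^ (d + 1) * (n * r) ≤ ((n - 2 * d : ℕ) : ℝ) * (r * (1 - q) ^ d) := by
    calc (1 / 2) ^ (d + 1) * (n * r) = (n : ℝ) / 2 * (r * (1 / 2) ^ d) := by ring
      _ ≤ _ := by gcongr
  have hexp : Real.exp (-(ε / 2 * (((n - 2 * d : ℕ) : ℝ) * (r * (1 - q) ^ d)))) ≤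
      Real.exp (-(ε / 2 * (1 / 2) ^ (d + 1) * (n : ℝ) ^ (1 - (d : ℝ) * α))) := by
    rw [hnr, Real.exp_le_exp, neg_le_neg_iff, mul_assoc]
    exact mul_le_mul_of_nonneg_left hmean (by positivity)
  have := mul_le_mul (show ((n - 2 * d : ℕ) : ℝ) + 4 ≤ n + 4 by linarith) hexp
    (Real.exp_pos _).le (by positivity)
  linarith
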